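/- Let $s_\lambda$ denote the Schur function of the partition $\lambda$ in variables $x_1,x_2,\dots$ (with coefficients in any commutative ring), i.e. $s_\lambda=\sum_T x^{T}$ over semistandard Young tableaux $T$ of shape $\lambda$, and write $(3^a,2^b,1^c)$ for the partition with $a$ parts $3$, $b$ parts $2$ and $c$ parts $1$; by convention $s_{(3^a,2^b,1^c)}=0$ if one of $a,b,c$ is negative. For integers $m,i$ put $$D_{m,i}=s_{(2^{i})}s_{(2^{m-i-1})}+s_{(2^{i-1},1^2)}s_{(2^{m-i-1})}-s_{(2^{i-1},1)}s_{(2^{m-i-1},1)}.$$ For a symmetric function with Schur expansion $f=\sum_\lambda a_\lambda s_\lambda$ (a finite sum) let $\Delta^{(2)}(f)=\sum_\lambda a_\lambda s_{\lambda\cup(2)}$, where $\lambda\cup(2)$ is the partition obtained from $\lambda$ by inserting one additional part equal to $2$. **Theorem.** Let $m=2k$ for some integer $k\ge 0$. (i) We have $$D_{m,k-1}=s_{(3^k)}s_{(1^{k-2})}+\Delta^{(2)}\bigl(s_{(3^{k-1})}s_{(1^{k-1})}\bigr),\qquad D_{m,k}=-s_{(3^k)}s_{(1^{k-2})}.$$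 (ii) For every $0\le i\le k-2$ we have $$D_{m,i}=\Delta^{(2)}(D_{m-1,i}),\qquad D_{m,m-i}=\Delta^{(2)}(D_{m-1,m-1-i}),$$ and moreover $$D_{m,m-k+1}=\Delta^{(2)}(D_{m-1,m-k}).$$ -/

import Mathlib

noncomputable section

namespace SymmFun

/-- The partition (Young diagram) whose nonzero parts are the nonzero elements of the multiset
`s`, rearranged in weakly decreasing order. -/
def ofParts (s : Multiset ℕ) : YoungDiagram :=
  YoungDiagram.ofRowLens (s.sort (· ≥ ·)) (Multiset.pairwise_sort s (· ≥ ·)).sortedGE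

/-- The multiset of (nonzero) parts of a partition. -/
def parts (μ : YoungDiagram) : Multiset ℕ := (μ.rowLens : Multiset ℕ)

/-- `union μ ν` is the partition `μ ∪ ν`: the union, with multiplicity, of all parts of `μ` and
`ν`, rearranged in weakly decreasing order. -/
def union (μ ν : YoungDiagram) : YoungDiagram := ofParts (parts μ + parts ν)

/-- The type of a semistandard tableau `T`, as an exponent vector: the multiplicity of `i` is
the number of cells with entry `i`. (Entries, and the variables, are indexed from `0`.) -/
def content {μ : YoungDiagram} (T : SemistandardYoungTableau μ) : ℕ →₀ ℕ :=
  ∑ c ∈ μ.cells, Finsupp.single (T c.1 c.2) 1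

theorem content_apply {μ : YoungDiagram} (T : SemistandardYoungTableau μ) (i : ℕ) :
    content T i = (μ.cells.filter (fun c => T c.1 c.2 = i)).card := by
  rw [content, Finsupp.finsetSum_apply, Finset.card_filter]
  exact Finset.sum_congr rfl fun c _ => Finsupp.single_apply

/-- The Schur function `s_μ = ∑_T x^{type T}` in the variables `x₀, x₁, …` over `R`: the
coefficient of `x^α` is the number of semistandard tableaux of shape `μ` and type `α`
(a finite number, see `finite_content_eq`). -/
def schur (R : Type*) [CommRing R] (μ : YoungDiagram) : MvPowerSeries ℕ R :=
  fun α => (Nat.card {T : SemistandardYoungTableau μ // content T = α} : R)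

theorem coeff_schur (R : Type*) [CommRing R] (μ : YoungDiagram) (α : ℕ →₀ ℕ) :
    MvPowerSeries.coeff α (schur R μ) =
      (Nat.card {T : SemistandardYoungTableau μ // content T = α} : R) := rfl

theorem finite_content_eq (μ : YoungDiagram) (α : ℕ →₀ ℕ) :
    Finite {T : SemistandardYoungTableau μ // content T = α} := by
  have key : ∀ (T : {T : SemistandardYoungTableau μ // content T = α}) (c : μ.cells),
      T.1 c.1.1 c.1.2 ∈ α.support := by
    rintro ⟨T, rfl⟩ ⟨c, hc⟩
    rw [Finsupp.mem_support_iff, content_apply]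
    exact Finset.card_ne_zero_of_mem (Finset.mem_filter.2 ⟨hc, rfl⟩)
  refine Finite.of_injective
    (fun T => fun c : μ.cells => (⟨T.1 c.1.1 c.1.2, key T c⟩ : α.support)) ?_
  intro T T' h
  apply Subtype.ext
  ext i j
  by_cases hc : (i, j) ∈ μ
  · simpa using congrArg Subtype.val (congrFun h ⟨(i, j), (YoungDiagram.mem_cells _).2 hc⟩)
  · rw [T.1.zeros hc, T'.1.zeros hc]

/-- The sum of the row indices of the cells of `μ`. -/
def rowWeight (μ : YoungDiagram) : ℕ := ∑ c ∈ μ.cells, c.1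

theorem le_entry {μ : YoungDiagram} (T : SemistandardYoungTableau μ) {i j : ℕ}
    (h : (i, j) ∈ μ) : i ≤ T i j := by
  induction i with
  | zero => exact Nat.zero_le _
  | succ i ih =>
    have h1 := ih (μ.up_left_mem (Nat.le_succ i) le_rfl h)
    have h2 := T.col_strict (Nat.lt_succ_self i) h
    simp only [Nat.succ_eq_add_one] at h2 h1
    omega

theorem sum_content {μ : YoungDiagram} (T : SemistandardYoungTableau μ) :
    (content T).sum (fun i n => n * i) = ∑ c ∈ μ.cells, T c.1 c.2 := by
  classical
  unfold content
  rw [← Finsupp.sum_finsetSum_index (by simp) (by intros; ring)]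
  simp

theorem sum_highestWeight (μ : YoungDiagram) :
    ∑ c ∈ μ.cells, SemistandardYoungTableau.highestWeight μ c.1 c.2 = rowWeight μ := by
  refine Finset.sum_congr rfl fun c hc => ?_
  simp [show (c.1, c.2) ∈ μ from (YoungDiagram.mem_cells _).1 hc]

theorem content_highestWeight (μ : YoungDiagram) (i : ℕ) :
    content (SemistandardYoungTableau.highestWeight μ) i = μ.rowLen i := by
  rw [content_apply, YoungDiagram.rowLen_eq_card]
  congr 1
  ext c
  simp only [Finset.mem_filter, YoungDiagram.mem_cells, YoungDiagram.mem_row_iff]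
  refine and_congr_right fun hc => ?_
  simp [show (c.1, c.2) ∈ μ from hc]

theorem eq_of_content_eq {μ ν : YoungDiagram} (T : SemistandardYoungTableau μ)
    (h : content T = content (SemistandardYoungTableau.highestWeight ν))
    (hw : rowWeight ν ≤ rowWeight μ) :
    μ = ν ∧ T = SemistandardYoungTableau.highestWeight μ := by
  have h1 : ∑ c ∈ μ.cells, T c.1 c.2 = rowWeight ν := by
    rw [← sum_content, h, sum_content, sum_highestWeight]
  have hle : ∀ c ∈ μ.cells, c.1 ≤ T c.1 c.2 := fun c hc =>
    le_entry T ((YoungDiagram.mem_cells _).1 hc)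
  have h2 : ∑ c ∈ μ.cells, c.1 = ∑ c ∈ μ.cells, T c.1 c.2 :=
    le_antisymm (Finset.sum_le_sum hle) (h1.le.trans hw)
  have h3 := (Finset.sum_eq_sum_iff_of_le hle).1 h2
  have hT : T = SemistandardYoungTableau.highestWeight μ := by
    ext i j
    by_cases hc : (i, j) ∈ μ
    · simp only [SemistandardYoungTableau.highestWeight_apply, if_pos hc]
      exact (h3 (i, j) ((YoungDiagram.mem_cells _).2 hc)).symm
    · rw [T.zeros hc, SemistandardYoungTableau.zeros _ hc]
  refine ⟨?_, hT⟩
  ext ⟨i, j⟩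
  have h4 : μ.rowLen i = ν.rowLen i := by
    rw [← content_highestWeight, ← content_highestWeight, ← h, hT]
  rw [YoungDiagram.mem_cells, YoungDiagram.mem_cells, YoungDiagram.mem_iff_lt_rowLen,
    YoungDiagram.mem_iff_lt_rowLen, h4]

/-- The Schur functions are linearly independent, so Schur expansions are unique. -/
theorem linearIndependent_schur (R : Type*) [CommRing R] :
    LinearIndependent R (schur R) := by
  rw [linearIndependent_iff]
  intro a ha
  by_contra hne
  obtain ⟨ν, hν, hmin⟩ :=
    Finset.exists_min_image a.support rowWeight (Finsupp.support_nonempty_iff.2 hne)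
  have h := congrArg
    (MvPowerSeries.coeff (content (SemistandardYoungTableau.highestWeight ν))) ha
  rw [Finsupp.linearCombination_apply, Finsupp.sum, map_sum] at h
  simp only [map_smul, smul_eq_mul, map_zero, coeff_schur] at h
  rw [Finset.sum_eq_single_of_mem ν hν] at h
  · have huniq : Nat.card {T : SemistandardYoungTableau ν //
        content T = content (SemistandardYoungTableau.highestWeight ν)} = 1 := by
      rw [Nat.card_eq_one_iff_exists]
      refine ⟨⟨_, rfl⟩, fun T => Subtype.ext ?_⟩
      exact (eq_of_content_eq T.1 T.2 le_rfl).2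
    apply Finsupp.mem_support_iff.1 hν
    rwa [huniq, Nat.cast_one, mul_one] at h
  · intro μ hμ hμν
    have : IsEmpty {T : SemistandardYoungTableau μ //
        content T = content (SemistandardYoungTableau.highestWeight ν)} :=
      ⟨fun T => hμν (eq_of_content_eq T.1 T.2 (hmin μ hμ)).1⟩
    rw [Nat.card_of_isEmpty, Nat.cast_zero, mul_zero]

open Classical in
/-- The operator `Δ^μ`: if `f = ∑ a_λ s_λ` (a finite `R`-linear combination of Schur functions,
i.e. `f` is a symmetric function) then `Δ^μ f = ∑ a_λ s_{λ ∪ μ}`. The expansion is unique, so this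
does not depend on the choice, see `delta_linearCombination`. (Power series which are not
symmetric functions are sent to `0`; this value is irrelevant.) -/
def delta {R : Type*} [CommRing R] (μ : YoungDiagram) (f : MvPowerSeries ℕ R) :
    MvPowerSeries ℕ R :=
  if h : ∃ a : YoungDiagram →₀ R, Finsupp.linearCombination R (schur R) a = f then
    Finsupp.linearCombination R (fun ν => schur R (union ν μ)) h.choose
  else 0

theorem delta_linearCombination {R : Type*} [CommRing R] (μ : YoungDiagram)
    (a : YoungDiagram →₀ R) :
    delta μ (Finsupp.linearCombination R (schur R) a) =
      Finsupp.linearCombination R (fun ν => schur R (union ν μ)) a := by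
  have h : ∃ b : YoungDiagram →₀ R, Finsupp.linearCombination R (schur R) b =
      Finsupp.linearCombination R (schur R) a := ⟨a, rfl⟩
  rw [delta, dif_pos h]
  congr 1
  exact linearIndependent_schur R h.choose_spec

/-- The Schur function `s_{(3^a, 2^b, 1^c)}` for integers `a`, `b`, `c`, with the convention that
it is `0` when one of the exponents is negative. -/
def schurExp (R : Type*) [CommRing R] (a b c : ℤ) : MvPowerSeries ℕ R :=
  if 0 ≤ a ∧ 0 ≤ b ∧ 0 ≤ c then
    schur R (ofParts (Multiset.replicate a.toNat 3 + Multiset.replicate b.toNat 2 +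
      Multiset.replicate c.toNat 1))
  else 0

/-- `D_{m,i}^{(1)} = s_{(2^i)} s_{(2^{m-i-1})}`. -/
def D1 (R : Type*) [CommRing R] (m i : ℤ) : MvPowerSeries ℕ R :=
  schurExp R 0 i 0 * schurExp R 0 (m - i - 1) 0

/-- `D_{m,i}^{(2)} = s_{(2^{i-1},1^2)} s_{(2^{m-i-1})}`. -/
def D2 (R : Type*) [CommRing R] (m i : ℤ) : MvPowerSeries ℕ R :=
  schurExp R 0 (i - 1) 2 * schurExp R 0 (m - i - 1) 0

/-- `D_{m,i}^{(3)} = s_{(2^{i-1},1)} s_{(2^{m-i-1},1)}`. -/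
def D3 (R : Type*) [CommRing R] (m i : ℤ) : MvPowerSeries ℕ R :=
  schurExp R 0 (i - 1) 1 * schurExp R 0 (m - i - 1) 1

/-- `D_{m,i} = D_{m,i}^{(1)} + D_{m,i}^{(2)} - D_{m,i}^{(3)}`. -/
def D (R : Type*) [CommRing R] (m i : ℤ) : MvPowerSeries ℕ R :=
  D1 R m i + D2 R m i - D3 R m i

end SymmFun

end

/-! Everything is reduced to determinants in the elementary symmetric functions `e_r`. The dual
Jacobi–Trudi identity `colSchur_eq_jacobiTrudi` is obtained by adding one variable at a time:
removing the largest entry from tableaux removes a horizontal strip, and the determinant, expanded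
multilinearly from `e_r ↦ e_r + x e_{r-1}`, obeys the same recursion.

In terms of column lengths, inserting a part 2 adds 1 to the first two columns. On the determinant
`jt₄ a b c d` this means `(a, b) ↦ (a + 1, b + 1)`, which remains valid for non-partition indices as
long as straightening only permutes rows within the pairs `{a, b}` and `{c, d}` (`isDelta_jt₄`).
Laplace expansion writes `jt₄ a b c d` as `jt₂ a b * jt₂ c d` plus products with smaller `c + d`;
hence, by induction, multiplication by a two-column Schur function with short columns commutes with
`Δ^{(2)}` (`isDelta_jt₂_mul_jt₂`). This settles (ii) term by term.

For (i), the same induction with a single column (`isDelta_pieri`) evaluates the `Δ^{(2)}` term;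
what is left are Desnanot–Jacobi identities for 3 × 3 determinants. -/

noncomputable section

namespace SymmFun

/-! ### Partitions described by their column lengths -/

/-- A weakly decreasing sequence of nonnegative integers: the possible lengths of the first `N`
columns of a partition. -/
def IsColumns {N : ℕ} (c : Fin N → ℤ) : Prop := Antitone c ∧ ∀ j, 0 ≤ c j

/-- The Young diagram with at most `N` columns, whose column lengths are given by `c`
(when `IsColumns c`). -/
def colDiagram {N : ℕ} (c : Fin N → ℤ) : YoungDiagram where
  cells := ((Finset.range (Finset.univ.sup fun j => (c j).toNat)) ×ˢ (Finset.range N)).filter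
    -- Testing all columns up to `p.2`, not just column `p.2`, makes this a lower set even when `c`
    -- is not decreasing.
    fun p => ∀ j : Fin N, (j : ℕ) ≤ p.2 → (p.1 : ℤ) < c j
  isLowerSet := by
    rintro ⟨i, j⟩ ⟨i', j'⟩ ⟨hi, hj⟩ h
    simp only [Finset.coe_filter, Finset.mem_product, Finset.mem_range, Set.mem_ofPred_eq] at h ⊢
    simp only at hi hj
    refine ⟨⟨by omega, by omega⟩, fun l hl => ?_⟩
    have := h.2 l (by omega)
    omega

theorem mem_colDiagram {N : ℕ} {c : Fin N → ℤ} (hc : IsColumns c) {i j : ℕ} :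
    (i, j) ∈ colDiagram c ↔ ∃ h : j < N, (i : ℤ) < c ⟨j, h⟩ := by
  rw [← YoungDiagram.mem_cells]
  simp only [colDiagram, Finset.mem_filter, Finset.mem_product, Finset.mem_range]
  constructor
  · rintro ⟨⟨-, hj⟩, h⟩
    exact ⟨hj, h ⟨j, hj⟩ le_rfl⟩
  · rintro ⟨hj, h⟩
    refine ⟨⟨?_, hj⟩, fun l hl => h.trans_le (hc.1 hl)⟩
    have : (c ⟨j, hj⟩).toNat ≤ Finset.univ.sup fun j => (c j).toNat :=
      Finset.le_sup (f := fun j => (c j).toNat) (Finset.mem_univ _)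
    omega

theorem colLen_colDiagram {N : ℕ} {c : Fin N → ℤ} (hc : IsColumns c) (j : ℕ) :
    ((colDiagram c).colLen j : ℤ) = if h : j < N then c ⟨j, h⟩ else 0 := by
  have key : ∀ i : ℕ, i < (colDiagram c).colLen j ↔ ∃ h : j < N, (i : ℤ) < c ⟨j, h⟩ := fun i => by
    rw [← YoungDiagram.mem_iff_lt_colLen, mem_colDiagram hc]
  split_ifs with h
  · have h0 := hc.2 ⟨j, h⟩
    have h1 := key (c ⟨j, h⟩).toNat
    have h2 := key ((colDiagram c).colLen j)
    simp only [h, exists_true_left] at h1 h2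
    omega
  · have := key 0
    simp only [h, IsEmpty.exists_iff, iff_false] at this
    omega

open Classical in
/-- The Schur function of the partition with column lengths `c`; zero if `c` is not a sequence of
column lengths. -/
def colSchur (R : Type*) [CommRing R] {N : ℕ} (c : Fin N → ℤ) : MvPowerSeries ℕ R :=
  if IsColumns c then schur R (colDiagram c) else 0

/-- Shorten by one the columns whose index is in `s`. -/
def removeStrip {N : ℕ} (c : Fin N → ℤ) (s : Finset (Fin N)) : Fin N → ℤ :=
  fun j => c j - if j ∈ s then 1 else 0

/-! ### Removing the largest entry of a tableau -/

section Strip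

variable {N : ℕ} {c : Fin N → ℤ} {s : Finset (Fin N)} {n : ℕ}

theorem mem_removeStrip (hc : IsColumns c) (hs : IsColumns (removeStrip c s)) {i j : ℕ} :
    (i, j) ∈ colDiagram (removeStrip c s) ↔
      (i, j) ∈ colDiagram c ∧ ∀ h : j < N, ⟨j, h⟩ ∈ s → (i : ℤ) + 1 < c ⟨j, h⟩ := by
  rw [mem_colDiagram hc, mem_colDiagram hs]
  simp only [removeStrip]
  constructor
  · rintro ⟨h, h'⟩
    refine ⟨⟨h, ?_⟩, fun _ h2 => ?_⟩ <;> split_ifs at h' <;> omega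
  · rintro ⟨⟨h, h1⟩, h2⟩
    refine ⟨h, ?_⟩
    split_ifs with h3
    · have := h2 h h3
      omega
    · omega

theorem removeStrip_le (hc : IsColumns c) (hs : IsColumns (removeStrip c s)) :
    (colDiagram (removeStrip c s)).cells ⊆ (colDiagram c).cells := by
  rintro ⟨i, j⟩ h
  rw [YoungDiagram.mem_cells] at h ⊢
  exact ((mem_removeStrip hc hs).1 h).1

theorem card_strip (hc : IsColumns c) (hs : IsColumns (removeStrip c s)) :
    ((colDiagram c).cells \ (colDiagram (removeStrip c s)).cells).card = s.card := by
  have hpos : ∀ j ∈ s, 1 ≤ c j := fun j hj => by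
    have := hs.2 j
    simp only [removeStrip, hj, if_true] at this
    omega
  symm
  refine Finset.card_bij (fun j _ => ((c j - 1).toNat, (j : ℕ))) ?_ ?_ ?_
  · intro j hj
    have := hpos j hj
    simp only [Finset.mem_sdiff, YoungDiagram.mem_cells, mem_removeStrip hc hs, not_and,
      mem_colDiagram hc]
    refine ⟨⟨j.2, by simp only [Fin.eta]; omega⟩, fun _ h => ?_⟩
    have := h j.2 hj
    simp only [Fin.eta] at this
    omega
  · intro j _ j' _ h
    exact Fin.ext (Prod.ext_iff.1 h).2
  · rintro ⟨i, j⟩ h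
    simp only [Finset.mem_sdiff, YoungDiagram.mem_cells, mem_removeStrip hc hs, not_and,
      mem_colDiagram hc] at h
    obtain ⟨⟨hj, hi⟩, h⟩ := h
    have h := h ⟨hj, hi⟩
    push Not at h
    obtain ⟨_, hjs, h⟩ := h
    refine ⟨⟨j, hj⟩, hjs, Prod.ext ?_ rfl⟩
    simp only
    omega

theorem content_eq_of_strip (hc : IsColumns c) (hs : IsColumns (removeStrip c s))
    (T : SemistandardYoungTableau (colDiagram c))
    (T' : SemistandardYoungTableau (colDiagram (removeStrip c s)))
    (h1 : ∀ i j, (i, j) ∈ colDiagram (removeStrip c s) → T i j = T' i j)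
    (h2 : ∀ i j, (i, j) ∈ colDiagram c → (i, j) ∉ colDiagram (removeStrip c s) → T i j = n) :
    content T = content T' + Finsupp.single n s.card := by
  rw [content, content, ← Finset.sum_sdiff (removeStrip_le hc hs), add_comm]
  congr 1
  · refine Finset.sum_congr rfl fun x hx => ?_
    rw [h1 x.1 x.2 hx]
  · rw [← card_strip hc hs, Finset.card_eq_sum_ones, Finsupp.single_finsetSum]
    refine Finset.sum_congr rfl fun x hx => ?_
    rw [Finset.mem_sdiff] at hx
    rw [h2 x.1 x.2 hx.1 hx.2]

theorem entry_mem_support {μ : YoungDiagram} (T : SemistandardYoungTableau μ) {i j : ℕ}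
    (h : (i, j) ∈ μ) : T i j ∈ (content T).support := by
  rw [Finsupp.mem_support_iff, content_apply]
  exact Finset.card_ne_zero_of_mem (Finset.mem_filter.2 ⟨(YoungDiagram.mem_cells _).2 h, rfl⟩)

/-- Fill the cells of a horizontal strip with the entry `n`. -/
def extendStrip (hc : IsColumns c) (hs : IsColumns (removeStrip c s))
    (T : SemistandardYoungTableau (colDiagram (removeStrip c s)))
    (hT : ∀ i j, (i, j) ∈ colDiagram (removeStrip c s) → T i j < n) :
    SemistandardYoungTableau (colDiagram c) where
  entry i j := if (i, j) ∈ colDiagram (removeStrip c s) then T i j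
    else if (i, j) ∈ colDiagram c then n else 0
  row_weak' := by
    intro i j1 j2 hj h
    by_cases h' : (i, j2) ∈ colDiagram (removeStrip c s)
    · rw [if_pos h', if_pos (YoungDiagram.up_left_mem _ le_rfl hj.le h')]
      exact T.row_weak hj h'
    · rw [if_neg h', if_pos h]
      split_ifs with h1
      · exact (hT _ _ h1).le
      · exact le_rfl
      · exact Nat.zero_le _
  col_strict' := by
    intro i1 i2 j hi h
    by_cases h' : (i2, j) ∈ colDiagram (removeStrip c s)
    · rw [if_pos h', if_pos (YoungDiagram.up_left_mem _ hi.le le_rfl h')]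
      exact T.col_strict hi h'
    · have h1 : (i1, j) ∈ colDiagram (removeStrip c s) := by
        rw [mem_removeStrip hc hs]
        refine ⟨YoungDiagram.up_left_mem _ hi.le le_rfl h, fun hj _ => ?_⟩
        obtain ⟨_, h2⟩ := (mem_colDiagram hc).1 h
        omega
      rw [if_neg h', if_pos h, if_pos h1]
      exact hT _ _ h1
  zeros' := by
    intro i j h
    rw [if_neg h, if_neg fun h' => h ((mem_removeStrip hc hs).1 h').1]

theorem extendStrip_apply (hc : IsColumns c) (hs : IsColumns (removeStrip c s))
    (T : SemistandardYoungTableau (colDiagram (removeStrip c s)))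
    (hT : ∀ i j, (i, j) ∈ colDiagram (removeStrip c s) → T i j < n) (i j : ℕ) :
    extendStrip hc hs T hT i j = if (i, j) ∈ colDiagram (removeStrip c s) then T i j
      else if (i, j) ∈ colDiagram c then n else 0 := rfl

theorem content_extendStrip (hc : IsColumns c) (hs : IsColumns (removeStrip c s))
    (T : SemistandardYoungTableau (colDiagram (removeStrip c s)))
    (hT : ∀ i j, (i, j) ∈ colDiagram (removeStrip c s) → T i j < n) :
    content (extendStrip hc hs T hT) = content T + Finsupp.single n s.card := by
  apply content_eq_of_strip hc hs
  · intro i j h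
    rw [extendStrip_apply, if_pos h]
  · intro i j h h'
    rw [extendStrip_apply, if_neg h', if_pos h]

/-- The strip can be read off the filled tableau, which gives injectivity in the branching
bijection. -/
theorem mem_strip_iff (hc : IsColumns c) (hs : IsColumns (removeStrip c s))
    (T : SemistandardYoungTableau (colDiagram (removeStrip c s)))
    (hT : ∀ i j, (i, j) ∈ colDiagram (removeStrip c s) → T i j < n) (j : Fin N) :
    j ∈ s ↔ ∃ i, (i, (j : ℕ)) ∈ colDiagram c ∧ extendStrip hc hs T hT i j = n := by
  constructor
  · intro hj
    have h0 := hs.2 j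
    simp only [removeStrip, hj, if_true] at h0
    have h1 : ((c j - 1).toNat, (j : ℕ)) ∈ colDiagram c :=
      (mem_colDiagram hc).2 ⟨j.2, by simp only [Fin.eta]; omega⟩
    refine ⟨_, h1, ?_⟩
    rw [extendStrip_apply, if_neg, if_pos h1]
    intro h2
    have h3 := ((mem_removeStrip hc hs).1 h2).2 j.2 hj
    simp only [Fin.eta] at h3
    omega
  · rintro ⟨i, hi, h⟩
    by_contra hj
    have h1 : (i, (j : ℕ)) ∈ colDiagram (removeStrip c s) :=
      (mem_removeStrip hc hs).2 ⟨hi, fun _ h' => absurd h' hj⟩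
    rw [extendStrip_apply, if_pos h1] at h
    exact (hT _ _ h1).ne h

/-- The columns of `T` that contain the entry `n`. -/
def stripOf (T : SemistandardYoungTableau (colDiagram c)) (n : ℕ) : Finset (Fin N) :=
  Finset.univ.filter fun j => ∃ i ∈ Finset.range ((c j).toNat), T i j = n

/-- Columns increase strictly and `n` is the maximal entry, so `n` can occur only at the bottom of a
column. -/
theorem mem_stripOf (hc : IsColumns c) (T : SemistandardYoungTableau (colDiagram c))
    (hT : ∀ i j, (i, j) ∈ colDiagram c → T i j ≤ n) (j : Fin N) :
    j ∈ stripOf T n ↔ 1 ≤ c j ∧ T (c j - 1).toNat j = n := by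
  simp only [stripOf, Finset.mem_filter, Finset.mem_univ, true_and, Finset.mem_range]
  constructor
  · rintro ⟨i, hi, h⟩
    refine ⟨by omega, ?_⟩
    have h1 : ((c j - 1).toNat, (j : ℕ)) ∈ colDiagram c :=
      (mem_colDiagram hc).2 ⟨j.2, by simp only [Fin.eta]; omega⟩
    exact le_antisymm (hT _ _ h1) (h ▸ T.col_weak (by omega) h1)
  · rintro ⟨h, h'⟩
    exact ⟨_, by omega, h'⟩

/-- The danger is a pair of columns of equal length of which only the left one is shortened. Rows
increase weakly, so an `n` at the bottom of the left column forces an `n` beside it in the right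
one. -/
theorem isColumns_stripOf (hc : IsColumns c) (T : SemistandardYoungTableau (colDiagram c))
    (hT : ∀ i j, (i, j) ∈ colDiagram c → T i j ≤ n) :
    IsColumns (removeStrip c (stripOf T n)) := by
  have hm := mem_stripOf hc T hT
  constructor
  · intro j j' hjj
    have h0 := hc.1 hjj
    have h1 := hc.2 j'
    simp only [removeStrip]
    by_cases hj : j ∈ stripOf T n
    · have hj2 := (hm j).1 hj
      by_cases he : c j = c j'
      · have : j' ∈ stripOf T n := by
          rw [hm]
          refine ⟨by omega, le_antisymm (hT _ _ ?_) ?_⟩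
          · exact (mem_colDiagram hc).2 ⟨j'.2, by simp only [Fin.eta]; omega⟩
          · rw [← hj2.2, ← he]
            apply T.row_weak_of_le hjj
            exact (mem_colDiagram hc).2 ⟨j'.2, by simp only [Fin.eta]; omega⟩
        rw [if_pos hj, if_pos this]
        omega
      · rw [if_pos hj]
        split_ifs <;> omega
    · rw [if_neg hj]
      split_ifs <;> omega
  · intro j
    have h1 := hc.2 j
    simp only [removeStrip]
    split_ifs with h
    · have := (hm j).1 h
      omega
    · omega

theorem mem_removeStrip_stripOf (hc : IsColumns c) (T : SemistandardYoungTableau (colDiagram c))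
    (hT : ∀ i j, (i, j) ∈ colDiagram c → T i j ≤ n) {i j : ℕ} :
    (i, j) ∈ colDiagram (removeStrip c (stripOf T n)) ↔ (i, j) ∈ colDiagram c ∧ T i j < n := by
  rw [mem_removeStrip hc (isColumns_stripOf hc T hT)]
  refine and_congr_right fun h => ?_
  obtain ⟨hj, hi⟩ := (mem_colDiagram hc).1 h
  have h1 : ((c ⟨j, hj⟩ - 1).toNat, j) ∈ colDiagram c :=
    (mem_colDiagram hc).2 ⟨hj, by omega⟩
  constructor
  · intro h2
    by_contra h3
    have h4 : T i j = n := le_antisymm (hT _ _ h) (not_lt.1 h3)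
    have h5 : (⟨j, hj⟩ : Fin N) ∈ stripOf T n := by
      rw [mem_stripOf hc T hT]
      refine ⟨by omega, le_antisymm (hT _ _ h1) ?_⟩
      rw [← h4]
      exact T.col_weak (by omega) h1
    have h6 := h2 hj h5
    have h7 := T.col_strict (i1 := i) (i2 := (c ⟨j, hj⟩ - 1).toNat) (by omega) h1
    have h8 := hT _ _ h1
    omega
  · intro h2 _ h3
    have h4 := ((mem_stripOf hc T hT _).1 h3).2
    simp only at h4
    by_contra h5
    have : (c ⟨j, hj⟩ - 1).toNat = i := by omega
    rw [this] at h4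
    omega

/-- Delete the cells with entry `n`. -/
def restrictStrip (hc : IsColumns c) (T : SemistandardYoungTableau (colDiagram c))
    (hT : ∀ i j, (i, j) ∈ colDiagram c → T i j ≤ n) :
    SemistandardYoungTableau (colDiagram (removeStrip c (stripOf T n))) where
  entry i j := if (i, j) ∈ colDiagram (removeStrip c (stripOf T n)) then T i j else 0
  row_weak' := by
    intro i j1 j2 hj h
    rw [if_pos h, if_pos (YoungDiagram.up_left_mem _ le_rfl hj.le h)]
    exact T.row_weak hj ((mem_removeStrip_stripOf hc T hT).1 h).1
  col_strict' := by
    intro i1 i2 j hi h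
    rw [if_pos h, if_pos (YoungDiagram.up_left_mem _ hi.le le_rfl h)]
    exact T.col_strict hi ((mem_removeStrip_stripOf hc T hT).1 h).1
  zeros' h := if_neg h

theorem restrictStrip_apply (hc : IsColumns c) (T : SemistandardYoungTableau (colDiagram c))
    (hT : ∀ i j, (i, j) ∈ colDiagram c → T i j ≤ n) (i j : ℕ) :
    restrictStrip hc T hT i j =
      if (i, j) ∈ colDiagram (removeStrip c (stripOf T n)) then T i j else 0 := rfl

theorem restrictStrip_lt (hc : IsColumns c) (T : SemistandardYoungTableau (colDiagram c))
    (hT : ∀ i j, (i, j) ∈ colDiagram c → T i j ≤ n) (i j : ℕ)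
    (h : (i, j) ∈ colDiagram (removeStrip c (stripOf T n))) : restrictStrip hc T hT i j < n := by
  rw [restrictStrip_apply, if_pos h]
  exact ((mem_removeStrip_stripOf hc T hT).1 h).2

theorem extendStrip_restrictStrip (hc : IsColumns c)
    (T : SemistandardYoungTableau (colDiagram c))
    (hT : ∀ i j, (i, j) ∈ colDiagram c → T i j ≤ n) :
    extendStrip hc (isColumns_stripOf hc T hT) (restrictStrip hc T hT)
      (restrictStrip_lt hc T hT) = T := by
  ext i j
  rw [extendStrip_apply, restrictStrip_apply]
  split_ifs with h1 h2
  · rfl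
  · exact le_antisymm (not_lt.1 fun h3 => h1 ((mem_removeStrip_stripOf hc T hT).2 ⟨h2, h3⟩))
      (hT _ _ h2)
  · exact (T.zeros h2).symm

open Classical in
/-- The branching rule for semistandard tableaux. -/
theorem card_tableaux_branching (hc : IsColumns c) (n k : ℕ) (α : ℕ →₀ ℕ)
    (hα : ∀ i ∈ α.support, i < n) :
    Nat.card {T : SemistandardYoungTableau (colDiagram c) //
        content T = α + Finsupp.single n k} =
      ∑ s : Finset (Fin N), if IsColumns (removeStrip c s) ∧ s.card = k then
        Nat.card {T : SemistandardYoungTableau (colDiagram (removeStrip c s)) // content T = α}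
      else 0 := by
  have hlt : ∀ (s : Finset (Fin N))
      (T : {T : SemistandardYoungTableau (colDiagram (removeStrip c s)) // content T = α}),
      ∀ i j, (i, j) ∈ colDiagram (removeStrip c s) → T.1 i j < n := by
    intro s T i j h
    have h1 := entry_mem_support T.1 h
    rw [T.2] at h1
    exact hα _ h1
  have hle : ∀ T : {T : SemistandardYoungTableau (colDiagram c) //
      content T = α + Finsupp.single n k}, ∀ i j, (i, j) ∈ colDiagram c → T.1 i j ≤ n := by
    intro T i j h
    have h1 := entry_mem_support T.1 h
    rw [T.2] at h1
    rcases Finset.mem_union.1 (Finsupp.support_add h1) with h2 | h2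
    · exact (hα _ h2).le
    · exact (Finset.mem_singleton.1 (Finsupp.support_single_subset h2)).le
  let F : (Σ s : {s : Finset (Fin N) // IsColumns (removeStrip c s) ∧ s.card = k},
      {T : SemistandardYoungTableau (colDiagram (removeStrip c s.1)) // content T = α}) →
      {T : SemistandardYoungTableau (colDiagram c) // content T = α + Finsupp.single n k} :=
    fun p => ⟨extendStrip hc p.1.2.1 p.2.1 (hlt _ p.2), by
      rw [content_extendStrip, p.2.2, p.1.2.2]⟩
  have hF : Function.Bijective F := by
    constructor
    · rintro ⟨⟨s, hs⟩, T⟩ ⟨⟨s', hs'⟩, T'⟩ h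
      have h := congrArg Subtype.val h
      simp only [F] at h
      have hss : s = s' := by
        ext j
        rw [mem_strip_iff hc hs.1 T.1 (hlt _ T), mem_strip_iff hc hs'.1 T'.1 (hlt _ T'), h]
      subst hss
      congr 1
      apply Subtype.ext
      ext i j
      by_cases hij : (i, j) ∈ colDiagram (removeStrip c s)
      · have h1 : extendStrip hc hs.1 T.1 (hlt _ T) i j = extendStrip hc hs.1 T'.1 (hlt _ T') i j :=
          by rw [h]
        rwa [extendStrip_apply, extendStrip_apply, if_pos hij, if_pos hij] at h1
      · rw [T.1.zeros hij, T'.1.zeros hij]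
    · intro T
      have h1 := extendStrip_restrictStrip hc T.1 (hle T)
      have h2 := content_extendStrip hc (isColumns_stripOf hc T.1 (hle T))
        (restrictStrip hc T.1 (hle T)) (restrictStrip_lt hc T.1 (hle T))
      rw [h1, T.2] at h2
      -- The exponent of `n` vanishes in `α` and in the restricted content, so comparing exponents
      -- at `n` gives the size of the strip.
      have h3 : (content (restrictStrip hc T.1 (hle T))) n = 0 := by
        rw [content_apply, Finset.card_eq_zero, Finset.filter_eq_empty_iff]
        intro x hx
        exact (restrictStrip_lt hc T.1 (hle T) x.1 x.2 hx).ne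
      have h4 : α n = 0 := by
        by_contra h4
        exact lt_irrefl _ (hα n (Finsupp.mem_support_iff.2 h4))
      have h5 : (stripOf T.1 n).card = k := by
        have := DFunLike.congr_fun h2 n
        simp only [Finsupp.add_apply, h3, h4, Finsupp.single_eq_same] at this
        omega
      rw [h5] at h2
      exact ⟨⟨⟨_, isColumns_stripOf hc T.1 (hle T), h5⟩, ⟨_, (add_right_cancel h2).symm⟩⟩,
        Subtype.ext h1⟩
  have hfin := fun s : Finset (Fin N) => finite_content_eq (colDiagram (removeStrip c s)) α
  rw [← Nat.card_congr (Equiv.ofBijective F hF), Nat.card_sigma, ← Finset.sum_filter,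
    ← Finset.sum_subtype_eq_sum_filter, Finset.subtype_univ]

end Strip

/-! ### Schur functions in finitely many variables -/

section Truncation

variable {R : Type*} [CommRing R]

open Classical in
/-- The part of a power series that involves only the variables `x_i` with `i < n`. -/
def truncFun (n : ℕ) (f : MvPowerSeries ℕ R) : MvPowerSeries ℕ R :=
  fun α => if ∀ i ∈ α.support, i < n then MvPowerSeries.coeff α f else 0

open Classical in
theorem coeff_truncFun (n : ℕ) (f : MvPowerSeries ℕ R) (α : ℕ →₀ ℕ) :
    MvPowerSeries.coeff α (truncFun n f) =
      if ∀ i ∈ α.support, i < n then MvPowerSeries.coeff α f else 0 := rfl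

/-- Set the variables `x_i` with `n ≤ i` to zero. -/
def truncVars (R : Type*) [CommRing R] (n : ℕ) : MvPowerSeries ℕ R →+* MvPowerSeries ℕ R where
  toFun := truncFun n
  map_one' := by
    classical
    ext α
    rw [coeff_truncFun]
    split_ifs with h
    · rfl
    · rw [MvPowerSeries.coeff_one, if_neg]
      rintro rfl
      simp at h
  map_zero' := by
    ext α
    simp [coeff_truncFun]
  map_add' f g := by
    ext α
    simp only [coeff_truncFun, map_add]
    split_ifs <;> simp
  map_mul' f g := by
    classical
    ext α
    simp only [coeff_truncFun, MvPowerSeries.coeff_mul]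
    split_ifs with h
    · refine Finset.sum_congr rfl fun p hp => ?_
      rw [Finset.HasAntidiagonal.mem_antidiagonal] at hp
      have hle : ∀ i, p.1 i + p.2 i = α i := fun i => by rw [← hp, Finsupp.add_apply]
      have hi : ∀ i, α i ≠ 0 → i < n := fun i hi => h i (Finsupp.mem_support_iff.2 hi)
      rw [if_pos, if_pos] <;>
      · intro i h1
        have h1 := Finsupp.mem_support_iff.1 h1
        have h2 := hle i
        exact hi i (by omega)
    · symm
      refine Finset.sum_eq_zero fun p hp => ?_
      rw [Finset.HasAntidiagonal.mem_antidiagonal] at hp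
      by_cases h1 : ∀ i ∈ p.1.support, i < n
      · rw [if_neg (c := ∀ i ∈ p.2.support, i < n), mul_zero]
        intro h2
        refine h fun i hi => ?_
        rw [← hp] at hi
        rcases Finset.mem_union.1 (Finsupp.support_add hi) with h3 | h3
        · exact h1 i h3
        · exact h2 i h3
      · rw [if_neg h1, zero_mul]

open Classical in
theorem coeff_truncVars (n : ℕ) (f : MvPowerSeries ℕ R) (α : ℕ →₀ ℕ) :
    MvPowerSeries.coeff α (truncVars R n f) =
      if ∀ i ∈ α.support, i < n then MvPowerSeries.coeff α f else 0 := rfl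

/-- Each monomial involves finitely many variables, so its coefficient is already seen by some
truncation. -/
theorem eq_of_truncVars_eq {f g : MvPowerSeries ℕ R}
    (h : ∀ n, truncVars R n f = truncVars R n g) : f = g := by
  ext α
  obtain ⟨n, hn⟩ := α.support.exists_nat_subset_range
  have h1 := congrArg (MvPowerSeries.coeff α) (h n)
  have h2 : ∀ i ∈ α.support, i < n := fun i hi => Finset.mem_range.1 (hn hi)
  rwa [coeff_truncVars, coeff_truncVars, if_pos h2, if_pos h2] at h1

theorem colSchur_of_isColumns {N : ℕ} {c : Fin N → ℤ} (hc : IsColumns c) :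
    colSchur R c = schur R (colDiagram c) := if_pos hc

/-- The branching rule for Schur functions. -/
theorem truncVars_succ_colSchur {N : ℕ} {c : Fin N → ℤ} (hc : IsColumns c) (n : ℕ) :
    truncVars R (n + 1) (colSchur R c) = ∑ s : Finset (Fin N),
      MvPowerSeries.X n ^ s.card * truncVars R n (colSchur R (removeStrip c s)) := by
  classical
  ext α
  simp only [map_sum, MvPowerSeries.X_pow_eq, MvPowerSeries.coeff_monomial_mul, one_mul,
    coeff_truncVars]
  by_cases hα : ∀ i ∈ α.support, i < n + 1
  · have hlt : ∀ i ∈ (α.erase n).support, i < n := by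
      intro i hi
      rw [Finsupp.support_erase, Finset.mem_erase] at hi
      have := hα i hi.2
      omega
    have hdec : α.erase n + Finsupp.single n (α n) = α := Finsupp.erase_add_single n α
    have hcard := card_tableaux_branching hc n (α n) _ hlt
    rw [hdec] at hcard
    rw [if_pos hα, colSchur_of_isColumns hc, coeff_schur, hcard, Nat.cast_sum]
    refine Finset.sum_congr rfl fun s _ => ?_
    by_cases hk : s.card = α n
    · have h1 : α - Finsupp.single n s.card = α.erase n := by
        rw [hk, tsub_eq_iff_eq_add_of_le (by rw [Finsupp.single_le_iff]), hdec]
      have h2 : Finsupp.single n s.card ≤ α := by rw [Finsupp.single_le_iff, hk]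
      rw [h1, if_pos hlt, if_pos h2, colSchur]
      by_cases hs : IsColumns (removeStrip c s)
      · rw [if_pos (And.intro hs hk), if_pos hs, coeff_schur]
      · rw [if_neg (fun h : _ ∧ _ => hs h.1), if_neg hs, Nat.cast_zero, map_zero]
    · rw [if_neg (fun h : _ ∧ _ => hk h.2), Nat.cast_zero]
      -- If the strip is larger than `α n`, the power of `X n` does not divide the monomial; if
      -- smaller, the quotient still contains `x_n` and is killed by the truncation.
      symm
      rw [ite_eq_right_iff]
      intro h
      rw [Finsupp.single_le_iff] at h
      refine if_neg fun h' => lt_irrefl n (h' n ?_)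
      rw [Finsupp.mem_support_iff, Finsupp.tsub_apply, Finsupp.single_eq_same]
      omega
  · rw [if_neg hα]
    symm
    refine Finset.sum_eq_zero fun s _ => ?_
    rw [ite_eq_right_iff]
    intro _
    refine if_neg fun h => hα fun i hi => ?_
    rcases eq_or_ne i n with rfl | hne
    · omega
    · refine (h i ?_).trans (Nat.lt_succ_self n)
      rw [Finsupp.mem_support_iff, Finsupp.tsub_apply, Finsupp.single_eq_of_ne hne]
      exact Finsupp.mem_support_iff.1 hi

theorem truncVars_zero_colSchur {N : ℕ} {c : Fin N → ℤ} (hc : IsColumns c) :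
    truncVars R 0 (colSchur R c) = if c = 0 then 1 else 0 := by
  classical
  ext α
  rw [coeff_truncVars, colSchur_of_isColumns hc, coeff_schur]
  by_cases hα : α = 0
  · subst hα
    rw [if_pos (by simp)]
    split_ifs with h
    · have hempty : ∀ i j, (i, j) ∉ colDiagram c := fun i j hij => by
        obtain ⟨hj, h1⟩ := (mem_colDiagram hc).1 hij
        rw [h, Pi.zero_apply] at h1
        omega
      rw [MvPowerSeries.coeff_one, if_pos rfl, Nat.card_eq_one_iff_exists.2, Nat.cast_one]
      refine ⟨⟨SemistandardYoungTableau.highestWeight _, ?_⟩, fun T => Subtype.ext ?_⟩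
      · rw [content]
        exact Finset.sum_eq_zero fun x hx => absurd ((YoungDiagram.mem_cells _).1 hx) (hempty _ _)
      · ext i j
        rw [T.1.zeros (hempty i j), SemistandardYoungTableau.zeros _ (hempty i j)]
    · obtain ⟨j, hj⟩ := Function.ne_iff.1 h
      have h0 := hc.2 j
      have h1 : (0, (j : ℕ)) ∈ colDiagram c :=
        (mem_colDiagram hc).2 ⟨j.2, by
          simp only [Fin.eta, Nat.cast_zero]; exact lt_of_le_of_ne h0 (Ne.symm hj)⟩
      have : IsEmpty {T : SemistandardYoungTableau (colDiagram c) // content T = 0} :=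
        ⟨fun T => by
          have h2 := entry_mem_support T.1 h1
          rw [T.2] at h2
          simp at h2⟩
      rw [Nat.card_of_isEmpty, Nat.cast_zero, map_zero]
  · rw [if_neg, eq_comm]
    · split_ifs
      · rw [MvPowerSeries.coeff_one, if_neg hα]
      · rw [map_zero]
    · intro h
      refine hα (Finsupp.support_eq_empty.1 (Finset.eq_empty_of_forall_notMem fun i hi => ?_))
      exact absurd (h i hi) (Nat.not_lt_zero i)

/-- The elementary symmetric function `e_r`, with `e_r = 0` for `r < 0`. -/
def esymm (R : Type*) [CommRing R] (r : ℤ) : MvPowerSeries ℕ R :=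
  colSchur R fun _ : Fin 1 => r

theorem isColumns_one_iff (r : ℤ) : IsColumns (fun _ : Fin 1 => r) ↔ 0 ≤ r :=
  ⟨fun h => h.2 0, fun h => ⟨antitone_const, fun _ => h⟩⟩

theorem esymm_of_neg {r : ℤ} (hr : r < 0) : esymm R r = 0 :=
  if_neg fun h => hr.not_ge ((isColumns_one_iff r).1 h)

theorem truncVars_zero_esymm (r : ℤ) : truncVars R 0 (esymm R r) = if r = 0 then 1 else 0 := by
  by_cases hr : 0 ≤ r
  · rw [esymm, truncVars_zero_colSchur ((isColumns_one_iff r).2 hr)]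
    congr 1
    simp [funext_iff]
  · rw [esymm_of_neg (not_le.1 hr), map_zero, if_neg (by omega)]

theorem truncVars_succ_esymm (n : ℕ) (r : ℤ) :
    truncVars R (n + 1) (esymm R r) =
      truncVars R n (esymm R r) + MvPowerSeries.X n * truncVars R n (esymm R (r - 1)) := by
  by_cases hr : 0 ≤ r
  · rw [esymm, truncVars_succ_colSchur ((isColumns_one_iff r).2 hr), esymm]
    have h : (Finset.univ : Finset (Finset (Fin 1))) = {∅, {0}} := by decide
    have h0 : removeStrip (fun _ : Fin 1 => r) ∅ = fun _ => r := by
      ext; simp [removeStrip]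
    have h1 : removeStrip (fun _ : Fin 1 => r) {0} = fun _ => r - 1 := by
      ext j; simp [removeStrip, Subsingleton.elim j 0]
    rw [h, Finset.sum_pair (by decide), h0, h1]
    simp
  · rw [esymm_of_neg (not_le.1 hr), esymm_of_neg (by omega)]
    simp

theorem esymm_zero : esymm R 0 = 1 := by
  refine eq_of_truncVars_eq fun n => ?_
  induction n with
  | zero => rw [truncVars_zero_esymm, if_pos rfl, map_one]
  | succ n ih => rw [truncVars_succ_esymm, ih, esymm_of_neg (by norm_num)]; simp

end Truncation

/-! ### The dual Jacobi–Trudi identity -/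

section DualJacobiTrudi

variable {A : Type*} [CommRing A]

/-- The dual Jacobi–Trudi determinant `det (f (c_i - i + j))`. -/
def jacobiTrudi (f : ℤ → A) {N : ℕ} (c : Fin N → ℤ) : A :=
  (Matrix.of fun i j : Fin N => f (c i - i + j)).det

/-- This matches the convention that `colSchur` vanishes off partitions. If monotonicity fails, two
equal adjacent columns became `r - 1, r`, and their rows coincide; if only nonnegativity fails, the
last row involves negative indices only. -/
theorem jacobiTrudi_removeStrip_eq_zero {f : ℤ → A} (hf : ∀ r < 0, f r = 0) {N : ℕ}
    {c : Fin N → ℤ} (hc : IsColumns c) {s : Finset (Fin N)} (hs : ¬ IsColumns (removeStrip c s)) :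
    jacobiTrudi f (removeStrip c s) = 0 := by
  obtain _ | N := N
  · exact absurd ⟨fun i => i.elim0, fun i => i.elim0⟩ hs
  by_cases ha : Antitone (removeStrip c s)
  · obtain ⟨j, hj⟩ : ∃ j, removeStrip c s j < 0 := by
      by_contra h
      push Not at h
      exact hs ⟨ha, h⟩
    have hl : removeStrip c s (Fin.last N) < 0 := (ha (Fin.le_last j)).trans_lt hj
    refine Matrix.det_eq_zero_of_row_eq_zero (Fin.last N) fun j => hf _ ?_
    have := j.2
    rw [Fin.val_last]
    omega
  · rw [Fin.antitone_iff_succ_le] at ha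
    push Not at ha
    obtain ⟨i, hi⟩ := ha
    have h1 : c i.succ ≤ c i.castSucc := hc.1 (Fin.castSucc_lt_succ).le
    have h2 : removeStrip c s i.succ = removeStrip c s i.castSucc + 1 := by
      simp only [removeStrip] at hi ⊢
      split_ifs at hi ⊢ <;> omega
    refine Matrix.det_zero_of_row_eq (i := i.castSucc) (j := i.succ) (Fin.castSucc_lt_succ).ne ?_
    ext j
    simp only [Matrix.of_apply, h2, Fin.val_succ, Fin.val_castSucc]
    congr 1
    push_cast
    ring

/-- Each row is a row for `c i` plus `x` times a row for `c i - 1`; multilinearity sums over the set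
`s` of rows where the second summand is chosen. -/
theorem jacobiTrudi_add_mul (f g : ℤ → A) (x : A) (hg : ∀ r, g r = f r + x * f (r - 1)) {N : ℕ}
    (c : Fin N → ℤ) :
    jacobiTrudi g c = ∑ s : Finset (Fin N), x ^ s.card * jacobiTrudi f (removeStrip c s) := by
  classical
  have h : jacobiTrudi g c = Matrix.detRowAlternating (R := A)
      ((fun i (j : Fin N) => x * f (c i - 1 - i + j)) + fun i (j : Fin N) => f (c i - i + j)) := by
    rw [jacobiTrudi, Matrix.detRowAlternating]
    congr 1
    ext i j
    rw [Matrix.of_apply, hg, add_comm]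
    simp only [Pi.add_apply]
    congr 3
    ring
  rw [h, ← AlternatingMap.coe_multilinearMap, MultilinearMap.map_add_univ]
  refine Finset.sum_congr rfl fun s _ => ?_
  have h1 : s.piecewise (fun i (j : Fin N) => x * f (c i - 1 - i + j))
      (fun i (j : Fin N) => f (c i - i + j)) =
      fun i => (if i ∈ s then x else 1) • fun j : Fin N => f (removeStrip c s i - i + j) := by
    ext i j
    by_cases hi : i ∈ s <;> simp [removeStrip, hi]
  rw [h1, MultilinearMap.map_smul_univ, Finset.prod_ite_mem, Finset.univ_inter, Finset.prod_const,
    smul_eq_mul]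
  rfl

end DualJacobiTrudi

variable {R : Type*} [CommRing R]

theorem truncVars_colSchur {N : ℕ} (n : ℕ) {c : Fin N → ℤ} (hc : IsColumns c) :
    truncVars R n (colSchur R c) = jacobiTrudi (fun r => truncVars R n (esymm R r)) c := by
  induction n generalizing c with
  | zero =>
    -- With no variables `e_r` is 1 for `r = 0` and 0 otherwise; above the diagonal the index `c i -
    -- i + j` is positive, so only the diagonal matters.
    rw [truncVars_zero_colSchur hc, jacobiTrudi, Matrix.det_of_isLowerTriangular]
    · simp only [Matrix.of_apply, sub_add_cancel, truncVars_zero_esymm]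
      split_ifs with h
      · simp [h]
      · obtain ⟨j, hj⟩ := Function.ne_iff.1 h
        exact (Finset.prod_eq_zero (Finset.mem_univ j) (if_neg hj)).symm
    · intro i j hij
      have h0 := hc.2 i
      have h1 : (i : ℕ) < j := hij
      rw [Matrix.of_apply, truncVars_zero_esymm, if_neg (by omega)]
  | succ n ih =>
    rw [truncVars_succ_colSchur hc, jacobiTrudi_add_mul _ _ _ (truncVars_succ_esymm n)]
    refine Finset.sum_congr rfl fun s _ => ?_
    by_cases hs : IsColumns (removeStrip c s)
    · rw [ih hs]
    · rw [jacobiTrudi_removeStrip_eq_zero (fun r hr => by rw [esymm_of_neg hr, map_zero]) hc hs,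
        colSchur, if_neg hs, map_zero]

/-- The dual Jacobi–Trudi identity. -/
theorem colSchur_eq_jacobiTrudi {N : ℕ} {c : Fin N → ℤ} (hc : IsColumns c) :
    colSchur R c = jacobiTrudi (esymm R) c := by
  refine eq_of_truncVars_eq fun n => ?_
  rw [truncVars_colSchur n hc, jacobiTrudi, jacobiTrudi, RingHom.map_det]
  rfl

/-! ### Inserting a part, in terms of columns -/

section Diagrams

theorem lt_countP_iff_of_sortedGE {w : List ℕ} (hw : w.SortedGE) (i j : ℕ) :
    i < w.countP (j < ·) ↔ ∃ h : i < w.length, j < w[i] := by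
  induction w generalizing i with
  | nil => simp
  | cons a w ih =>
    have hp := List.pairwise_cons.1 hw.pairwise
    have ih := ih hp.2.sortedGE
    rw [List.countP_cons]
    by_cases ha : j < a
    · obtain _ | i := i
      · simp [ha]
      · simp [ha, ih]
    · have h0 : w.countP (j < ·) = 0 := by
        rw [List.countP_eq_zero]
        intro x hx
        have := hp.1 x hx
        simp only [decide_eq_true_eq]
        omega
      obtain _ | i := i
      · simp [ha, h0]
      · have h1 := ih i
        rw [h0] at h1
        simp [ha, h0, ← h1]

theorem colLen_ofRowLens {w : List ℕ} (hw : w.SortedGE) (j : ℕ) :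
    (YoungDiagram.ofRowLens w hw).colLen j = w.countP (j < ·) := by
  refine eq_of_forall_lt_iff fun i => ?_
  rw [← YoungDiagram.mem_iff_lt_colLen, YoungDiagram.mem_ofRowLens, lt_countP_iff_of_sortedGE hw]

theorem colLen_ofParts (s : Multiset ℕ) (j : ℕ) :
    (ofParts s).colLen j = s.countP (j < ·) := by
  rw [ofParts, colLen_ofRowLens, ← Multiset.coe_countP, Multiset.sort_eq]

theorem countP_parts (μ : YoungDiagram) (j : ℕ) : (parts μ).countP (j < ·) = μ.colLen j := by
  rw [parts, Multiset.coe_countP, ← colLen_ofRowLens μ.rowLens_sorted,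
    YoungDiagram.ofRowLens_to_rowLens_eq_self]

/-- A column length counts the parts exceeding the column's index, and such counts add under union
of multisets. -/
theorem colLen_union (μ ν : YoungDiagram) (j : ℕ) :
    (union μ ν).colLen j = μ.colLen j + ν.colLen j := by
  rw [union, colLen_ofParts, Multiset.countP_add, countP_parts, countP_parts]

theorem ext_colLen {μ ν : YoungDiagram} (h : ∀ j, μ.colLen j = ν.colLen j) : μ = ν := by
  ext ⟨i, j⟩
  rw [YoungDiagram.mem_cells, YoungDiagram.mem_cells, YoungDiagram.mem_iff_lt_colLen,
    YoungDiagram.mem_iff_lt_colLen, h]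

theorem isColumns_four {a b c d : ℤ} (hab : b ≤ a) (hbc : c ≤ b) (hcd : d ≤ c) (hd : 0 ≤ d) :
    IsColumns ![a, b, c, d] := by
  constructor
  · rw [Fin.antitone_iff_succ_le]
    intro i
    fin_cases i <;> simpa
  · intro i
    fin_cases i <;> simp <;> omega

theorem colLen_colDiagram_four {a b c d : ℤ} (h : IsColumns ![a, b, c, d]) (j : ℕ) :
    ((colDiagram ![a, b, c, d]).colLen j : ℤ) =
      if j = 0 then a else if j = 1 then b else if j = 2 then c else if j = 3 then d else 0 := by
  rw [colLen_colDiagram h]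
  match j with
  | 0 | 1 | 2 | 3 => simp
  | j + 4 => simp

theorem colLen_ofParts_two (j : ℕ) : (ofParts {2}).colLen j = if j < 2 then 1 else 0 := by
  rw [colLen_ofParts, ← Multiset.cons_zero, Multiset.countP_cons, Multiset.countP_zero, zero_add]

theorem union_two {a b c d : ℤ} (hab : b ≤ a) (hbc : c ≤ b) (hcd : d ≤ c) (hd : 0 ≤ d) :
    union (colDiagram ![a, b, c, d]) (ofParts {2}) = colDiagram ![a + 1, b + 1, c, d] := by
  refine ext_colLen fun j => ?_
  zify
  rw [colLen_colDiagram_four (isColumns_four (by omega) (by omega) hcd hd), colLen_union,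
    Nat.cast_add, colLen_colDiagram_four (isColumns_four hab hbc hcd hd), colLen_ofParts_two]
  match j with
  | 0 | 1 | 2 | 3 => simp
  | j + 4 => simp

theorem ofParts_replicate (a b c : ℕ) :
    ofParts (Multiset.replicate a 3 + Multiset.replicate b 2 + Multiset.replicate c 1) =
      colDiagram ![(a + b + c : ℤ), a + b, a, 0] := by
  refine ext_colLen fun j => ?_
  zify
  rw [colLen_colDiagram_four (isColumns_four (by omega) (by omega) (by omega) le_rfl),
    colLen_ofParts, Multiset.countP_add, Multiset.countP_add]
  simp only [← Multiset.coe_replicate, Multiset.coe_countP, List.countP_replicate]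
  match j with
  | 0 | 1 | 2 | 3 => simp
  | j + 4 => simp

end Diagrams

/-! ### Explicit determinants: row exchange and Laplace expansion -/

section Determinants

variable {A : Type*} [CommRing A] (f : ℤ → A)

/-- The dual Jacobi–Trudi determinant with two rows. -/
def jt₂ (a b : ℤ) : A := f a * f b - f (a + 1) * f (b - 1)

/-- The dual Jacobi–Trudi determinant with three rows. -/
def jt₃ (a b c : ℤ) : A :=
  f a * (f b * f c - f (b + 1) * f (c - 1)) -
    f (a + 1) * (f (b - 1) * f c - f (b + 1) * f (c - 2)) +
      f (a + 2) * (f (b - 1) * f (c - 1) - f b * f (c - 2))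

/-- The dual Jacobi–Trudi determinant with four rows. -/
def jt₄ (a b c d : ℤ) : A :=
  f d * jt₃ f a b c -
    f (d - 1) * (jt₃ f (a + 1) b c + jt₃ f a (b + 1) c + jt₃ f a b (c + 1)) +
      f (d - 2) * (jt₃ f (a + 1) (b + 1) c + jt₃ f (a + 1) b (c + 1) + jt₃ f a (b + 1) (c + 1)) -
        f (d - 3) * jt₃ f (a + 1) (b + 1) (c + 1)

theorem jacobiTrudi_four (a b c d : ℤ) : jacobiTrudi f ![a, b, c, d] = jt₄ f a b c d := by
  rw [jacobiTrudi, Matrix.det_succ_row_zero]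
  simp only [Fin.sum_univ_four, Matrix.det_fin_three, Matrix.submatrix_apply, Matrix.of_apply]
  simp [Fin.succAbove, jt₄, jt₃, Fin.lt_def]
  ring_nf

/-- An exchange of the first two rows: row `i` depends only on the column length minus `i`, so
exchanging adjacent rows also shifts their lengths by one. -/
theorem jt₄_swap_left (a b c d : ℤ) : jt₄ f (b - 1) (a + 1) c d = -jt₄ f a b c d := by
  simp only [jt₄, jt₃]
  ring_nf

theorem jt₄_swap_right (a b c d : ℤ) : jt₄ f a b (d - 1) (c + 1) = -jt₄ f a b c d := by
  simp only [jt₄, jt₃]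
  ring_nf

theorem jt₄_eq_zero_left (a c d : ℤ) : jt₄ f a (a + 1) c d = 0 := by
  simp only [jt₄, jt₃]
  ring_nf

theorem jt₄_eq_zero_right (a b c : ℤ) : jt₄ f a b c (c + 1) = 0 := by
  simp only [jt₄, jt₃]
  ring_nf

/-- Laplace expansion along the first two rows, in terms of raising operators. -/
theorem jt₄_eq_sum_jt₂ (a b c d : ℤ) :
    jt₄ f a b c d = jt₂ f a b * jt₂ f c d
      - jt₂ f (a + 1) b * jt₂ f (c - 1) d - jt₂ f (a + 1) b * jt₂ f c (d - 1)
      - jt₂ f a (b + 1) * jt₂ f (c - 1) d - jt₂ f a (b + 1) * jt₂ f c (d - 1)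
      + jt₂ f (a + 2) b * jt₂ f (c - 1) (d - 1) + jt₂ f a (b + 2) * jt₂ f (c - 1) (d - 1)
      + jt₂ f (a + 1) (b + 1) * jt₂ f (c - 2) d + jt₂ f (a + 1) (b + 1) * jt₂ f c (d - 2)
      + 2 * (jt₂ f (a + 1) (b + 1) * jt₂ f (c - 1) (d - 1))
      - jt₂ f (a + 2) (b + 1) * jt₂ f (c - 2) (d - 1)
      - jt₂ f (a + 2) (b + 1) * jt₂ f (c - 1) (d - 2)
      - jt₂ f (a + 1) (b + 2) * jt₂ f (c - 2) (d - 1)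
      - jt₂ f (a + 1) (b + 2) * jt₂ f (c - 1) (d - 2)
      + jt₂ f (a + 2) (b + 2) * jt₂ f (c - 2) (d - 2) := by
  simp only [jt₄, jt₃, jt₂]
  ring_nf

end Determinants

/-! ### Products that commute with inserting a part 2 -/

section Delta

/-- `g` is the image under `Δ^{(2)}` of the symmetric function `f`. -/
def IsDelta (f g : MvPowerSeries ℕ R) : Prop :=
  ∃ a : YoungDiagram →₀ R, Finsupp.linearCombination R (schur R) a = f ∧
    Finsupp.linearCombination R (fun ν => schur R (union ν (ofParts {2}))) a = g

/-- Working with the relation makes additivity immediate; uniqueness of Schur expansions is needed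
only at this passage to the operator. -/
theorem IsDelta.delta_eq {f g : MvPowerSeries ℕ R} (h : IsDelta f g) :
    delta (ofParts {2}) f = g := by
  obtain ⟨a, rfl, rfl⟩ := h
  exact delta_linearCombination _ a

theorem IsDelta.zero : IsDelta (0 : MvPowerSeries ℕ R) 0 := ⟨0, map_zero _, map_zero _⟩

theorem IsDelta.add {f g f' g' : MvPowerSeries ℕ R} (h : IsDelta f g) (h' : IsDelta f' g') :
    IsDelta (f + f') (g + g') := by
  obtain ⟨a, rfl, rfl⟩ := h
  obtain ⟨b, rfl, rfl⟩ := h'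
  exact ⟨a + b, map_add _ _ _, map_add _ _ _⟩

theorem IsDelta.neg {f g : MvPowerSeries ℕ R} (h : IsDelta f g) : IsDelta (-f) (-g) := by
  obtain ⟨a, rfl, rfl⟩ := h
  exact ⟨-a, map_neg _ _, map_neg _ _⟩

theorem IsDelta.sub {f g f' g' : MvPowerSeries ℕ R} (h : IsDelta f g) (h' : IsDelta f' g') :
    IsDelta (f - f') (g - g') := by
  rw [sub_eq_add_neg, sub_eq_add_neg]
  exact h.add h'.neg

theorem jt₄_esymm {a b c d : ℤ} (hab : b ≤ a) (hbc : c ≤ b) (hcd : d ≤ c) (hd : 0 ≤ d) :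
    jt₄ (esymm R) a b c d = schur R (colDiagram ![a, b, c, d]) := by
  have h := isColumns_four hab hbc hcd hd
  rw [← jacobiTrudi_four, ← colSchur_eq_jacobiTrudi h, colSchur_of_isColumns h]

theorem jt₄_esymm_of_neg (a b c : ℤ) {d : ℤ} (hd : d < 0) : jt₄ (esymm R) a b c d = 0 := by
  rw [jt₄, esymm_of_neg hd, esymm_of_neg (r := d - 1) (by omega),
    esymm_of_neg (r := d - 2) (by omega), esymm_of_neg (r := d - 3) (by omega)]
  ring

theorem isDelta_jt₄_of_le {a b c d : ℤ} (hab : b ≤ a) (hbc : c ≤ b) (hcd : d ≤ c) :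
    IsDelta (jt₄ (esymm R) a b c d) (jt₄ (esymm R) (a + 1) (b + 1) c d) := by
  by_cases hd : 0 ≤ d
  · refine ⟨Finsupp.single (colDiagram ![a, b, c, d]) 1, ?_, ?_⟩
    · rw [Finsupp.linearCombination_single, one_smul, jt₄_esymm hab hbc hcd hd]
    · rw [Finsupp.linearCombination_single, one_smul, union_two hab hbc hcd hd,
        jt₄_esymm (by omega) (by omega) hcd hd]
  · rw [jt₄_esymm_of_neg _ _ _ (not_le.1 hd), jt₄_esymm_of_neg _ _ _ (not_le.1 hd)]
    exact IsDelta.zero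

/-- The hypotheses say that the shifted indices `a`, `b - 1` both exceed `c - 2`, `d - 3`.
Straightening therefore only exchanges rows within each pair, with the same sign before and after
the first two lengths grow by 1. -/
theorem isDelta_jt₄ {a b c d : ℤ} (hbc : c ≤ b) (hac : c ≤ a + 1) (hbd : d ≤ b + 1)
    (had : d ≤ a + 2) :
    IsDelta (jt₄ (esymm R) a b c d) (jt₄ (esymm R) (a + 1) (b + 1) c d) := by
  have key : ∀ {c d : ℤ}, c ≤ b → c ≤ a + 1 → d ≤ c →
      IsDelta (jt₄ (esymm R) a b c d) (jt₄ (esymm R) (a + 1) (b + 1) c d) := by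
    intro c d hbc hac hcd
    rcases lt_trichotomy (a + 1) b with h | h | h
    · have h1 := isDelta_jt₄_of_le (R := R) (a := b - 1) (b := a + 1) (by omega) hac hcd
      rw [jt₄_swap_left, show b - 1 + 1 = b + 1 - 1 by ring, jt₄_swap_left] at h1
      simpa using h1.neg
    · subst h
      rw [jt₄_eq_zero_left, jt₄_eq_zero_left]
      exact IsDelta.zero
    · exact isDelta_jt₄_of_le (by omega) hbc hcd
  rcases lt_trichotomy (c + 1) d with h | h | h
  · have h1 := key (c := d - 1) (d := c + 1) (by omega) (by omega) (by omega)
    rw [jt₄_swap_right, jt₄_swap_right] at h1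
    simpa using h1.neg
  · subst h
    rw [jt₄_eq_zero_right, jt₄_eq_zero_right]
    exact IsDelta.zero
  · exact key hbc hac (by omega)

theorem jt₂_esymm_of_neg {a b : ℤ} (h : a + b < 0) : jt₂ (esymm R) a b = 0 := by
  rw [jt₂]
  have h1 : esymm R a * esymm R b = 0 := by
    rcases lt_or_ge a 0 with h | h
    · rw [esymm_of_neg h, zero_mul]
    · rw [esymm_of_neg (r := b) (by omega), mul_zero]
  have h2 : esymm R (a + 1) * esymm R (b - 1) = 0 := by
    rcases lt_or_ge (a + 1) 0 with h | h
    · rw [esymm_of_neg h, zero_mul]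
    · rw [esymm_of_neg (r := b - 1) (by omega), mul_zero]
  rw [h1, h2, sub_zero]

/-- Multiplying a two-column Schur function by another one whose columns are all at least as long
commutes with inserting a part equal to `2`. -/
theorem isDelta_jt₂_mul_jt₂ {a b c d : ℤ} (hbc : c ≤ b) (hac : c ≤ a + 1) (hbd : d ≤ b + 1)
    (had : d ≤ a + 2) :
    IsDelta (jt₂ (esymm R) a b * jt₂ (esymm R) c d)
      (jt₂ (esymm R) (a + 1) (b + 1) * jt₂ (esymm R) c d) := by
  obtain ⟨n, hn⟩ : ∃ n : ℕ, c + d < n := ⟨(c + d + 1).toNat, by omega⟩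
  induction n using Nat.strong_induction_on generalizing a b c d with
  | _ n ih =>
    by_cases hneg : c + d < 0
    · rw [jt₂_esymm_of_neg hneg, mul_zero, mul_zero]
      exact IsDelta.zero
    -- Raising operators lengthen `a, b` and shorten `c, d`: the hypotheses persist and `c + d`
    -- drops, so the induction hypothesis covers every correction term.
    have key : ∀ x y z w : ℤ, 0 ≤ x → 0 ≤ y → 0 ≤ z → 0 ≤ w → 0 < z + w →
        IsDelta (jt₂ (esymm R) (a + x) (b + y) * jt₂ (esymm R) (c - z) (d - w))
          (jt₂ (esymm R) (a + 1 + x) (b + 1 + y) * jt₂ (esymm R) (c - z) (d - w)) := by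
      intro x y z w hx hy hz hw hzw
      rw [add_right_comm a 1 x, add_right_comm b 1 y]
      exact ih (n - 1) (by omega) (by omega) (by omega) (by omega) (by omega) (by omega)
    have h0 := isDelta_jt₄ (R := R) hbc hac hbd had
    rw [jt₄_eq_sum_jt₂, jt₄_eq_sum_jt₂ _ (a + 1)] at h0
    have h1 := key 1 0 1 0 (by simp) (by simp) (by simp) (by simp) (by simp)
    have h2 := key 1 0 0 1 (by simp) (by simp) (by simp) (by simp) (by simp)
    have h3 := key 0 1 1 0 (by simp) (by simp) (by simp) (by simp) (by simp)
    have h4 := key 0 1 0 1 (by simp) (by simp) (by simp) (by simp) (by simp)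
    have h5 := key 2 0 1 1 (by simp) (by simp) (by simp) (by simp) (by simp)
    have h6 := key 0 2 1 1 (by simp) (by simp) (by simp) (by simp) (by simp)
    have h7 := key 1 1 2 0 (by simp) (by simp) (by simp) (by simp) (by simp)
    have h8 := key 1 1 0 2 (by simp) (by simp) (by simp) (by simp) (by simp)
    have h9 := key 1 1 1 1 (by simp) (by simp) (by simp) (by simp) (by simp)
    have h10 := key 2 1 2 1 (by simp) (by simp) (by simp) (by simp) (by simp)
    have h11 := key 2 1 1 2 (by simp) (by simp) (by simp) (by simp) (by simp)
    have h12 := key 1 2 2 1 (by simp) (by simp) (by simp) (by simp) (by simp)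
    have h13 := key 1 2 1 2 (by simp) (by simp) (by simp) (by simp) (by simp)
    have h14 := key 2 2 2 2 (by simp) (by simp) (by simp) (by simp) (by simp)
    simp only [add_zero, sub_zero] at h1 h2 h3 h4 h5 h6 h7 h8 h9 h10 h11 h12 h13 h14
    -- The Laplace expansion solved for its leading product. `h9` enters twice because two different
    -- pairs of raising operators yield that term.
    have h := (((((((((((((((h0.add h1).add h2).add h3).add h4).sub h5).sub h6).sub h7).sub
      h8).sub h9).sub h9).add h10).add h11).add h12).add h13).sub h14)
    convert h using 1 <;> ring

end Delta

/-! ### Determinantal form of `D` and part (ii) -/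

theorem schurExp_of_nonneg {a b c : ℤ} (ha : 0 ≤ a) (hb : 0 ≤ b) (hc : 0 ≤ c) :
    schurExp R a b c = jt₄ (esymm R) (a + b + c) (a + b) a 0 := by
  rw [schurExp, if_pos ⟨ha, hb, hc⟩, ofParts_replicate, Int.toNat_of_nonneg ha,
    Int.toNat_of_nonneg hb, Int.toNat_of_nonneg hc, jt₄_esymm] <;> omega

theorem jt₄_esymm_zero (a b c : ℤ) : jt₄ (esymm R) a b c 0 = jt₃ (esymm R) a b c := by
  rw [jt₄, esymm_zero, esymm_of_neg (r := 0 - 1) (by norm_num),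
    esymm_of_neg (r := 0 - 2) (by norm_num), esymm_of_neg (r := 0 - 3) (by norm_num)]
  ring

theorem jt₃_esymm_zero (a b : ℤ) : jt₃ (esymm R) a b 0 = jt₂ (esymm R) a b := by
  rw [jt₃, jt₂, esymm_zero, esymm_of_neg (r := 0 - 1) (by norm_num),
    esymm_of_neg (r := 0 - 2) (by norm_num)]
  ring

/-- For negative `b` both products in `jt₂` contain an `e_r` with `r < 0`, in agreement with the
zero convention; so `D_eq` needs no bounds on `m` and `i`. -/
theorem schurExp_two_columns (b : ℤ) {c : ℤ} (hc : 0 ≤ c) :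
    schurExp R 0 b c = jt₂ (esymm R) (b + c) b := by
  by_cases hb : 0 ≤ b
  · rw [schurExp_of_nonneg le_rfl hb hc, jt₄_esymm_zero, jt₃_esymm_zero, zero_add]
  · rw [schurExp, if_neg (by omega), jt₂, esymm_of_neg (r := b) (by omega),
      esymm_of_neg (r := b - 1) (by omega)]
    ring

theorem schurExp_threes (a : ℤ) : schurExp R a 0 0 = jt₃ (esymm R) a a a := by
  by_cases ha : 0 ≤ a
  · rw [schurExp_of_nonneg ha le_rfl le_rfl, jt₄_esymm_zero, add_zero, add_zero]
  · rw [schurExp, if_neg (by omega), jt₃, esymm_of_neg (r := a) (by omega),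
      esymm_of_neg (r := a - 1) (by omega), esymm_of_neg (r := a - 2) (by omega)]
    ring

theorem schurExp_ones (c : ℤ) : schurExp R 0 0 c = esymm R c := by
  by_cases hc : 0 ≤ c
  · rw [schurExp_two_columns 0 hc, jt₂, esymm_zero, zero_add,
      esymm_of_neg (r := 0 - 1) (by norm_num)]
    ring
  · rw [schurExp, if_neg (by omega), esymm_of_neg (not_le.1 hc)]

theorem D_eq (m i : ℤ) : D R m i =
    jt₂ (esymm R) i i * jt₂ (esymm R) (m - i - 1) (m - i - 1) +
      jt₂ (esymm R) (i + 1) (i - 1) * jt₂ (esymm R) (m - i - 1) (m - i - 1) -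
        jt₂ (esymm R) i (i - 1) * jt₂ (esymm R) (m - i) (m - i - 1) := by
  rw [D, D1, D2, D3, schurExp_two_columns i le_rfl, schurExp_two_columns (m - i - 1) le_rfl,
    schurExp_two_columns (i - 1) zero_le_two, schurExp_two_columns (i - 1) zero_le_one,
    schurExp_two_columns (m - i - 1) zero_le_one]
  ring_nf

/-- Here the factors indexed by `m - i - 1` have the longer columns and absorb the new part in all
three products. -/
theorem isDelta_D_of_le {m i : ℤ} (h : 2 * i + 3 ≤ m - 1) : IsDelta (D R (m - 1) i) (D R m i) := by
  have h1 := isDelta_jt₂_mul_jt₂ (R := R) (a := m - i - 2) (b := m - i - 2) (c := i) (d := i)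
    (by omega) (by omega) (by omega) (by omega)
  have h2 := isDelta_jt₂_mul_jt₂ (R := R) (a := m - i - 2) (b := m - i - 2) (c := i + 1)
    (d := i - 1) (by omega) (by omega) (by omega) (by omega)
  have h3 := isDelta_jt₂_mul_jt₂ (R := R) (a := m - i - 1) (b := m - i - 2) (c := i)
    (d := i - 1) (by omega) (by omega) (by omega) (by omega)
  rw [D_eq, D_eq]
  convert (h1.add h2).sub h3 using 1 <;> ring_nf

/-- Now the factors indexed by `i` are the longer ones. The third product makes the bound sharp: it
needs `m - i ≤ i - 2`. -/
theorem isDelta_D_of_ge {m i : ℤ} (h : m + 2 ≤ 2 * i) :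
    IsDelta (D R (m - 1) (i - 1)) (D R m i) := by
  have h1 := isDelta_jt₂_mul_jt₂ (R := R) (a := i - 1) (b := i - 1) (c := m - i - 1)
    (d := m - i - 1) (by omega) (by omega) (by omega) (by omega)
  have h2 := isDelta_jt₂_mul_jt₂ (R := R) (a := i) (b := i - 2) (c := m - i - 1)
    (d := m - i - 1) (by omega) (by omega) (by omega) (by omega)
  have h3 := isDelta_jt₂_mul_jt₂ (R := R) (a := i - 1) (b := i - 2) (c := m - i)
    (d := m - i - 1) (by omega) (by omega) (by omega) (by omega)
  rw [D_eq, D_eq]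
  convert (h1.add h2).sub h3 using 1 <;> ring_nf

/-! ### The middle terms: part (i) -/

/-- Write `G a b c d` for the first expression: it is `jt₄` expanded along its last row with the
terms raising `a` left out. Restoring them gives `jt₄ a b c d = G a b c d - G (a + 1) b c (d - 1)`,
whence an induction on `d`. -/
theorem isDelta_pieri {a b c d : ℤ} (hbc : c ≤ b) (hac : c ≤ a + 1) (hbd : d ≤ b + 1)
    (had : d ≤ a + 2) :
    IsDelta
      (esymm R d * jt₃ (esymm R) a b c -
        esymm R (d - 1) * (jt₃ (esymm R) a (b + 1) c + jt₃ (esymm R) a b (c + 1)) +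
          esymm R (d - 2) * jt₃ (esymm R) a (b + 1) (c + 1))
      (esymm R d * jt₃ (esymm R) (a + 1) (b + 1) c -
        esymm R (d - 1) *
          (jt₃ (esymm R) (a + 1) (b + 2) c + jt₃ (esymm R) (a + 1) (b + 1) (c + 1)) +
          esymm R (d - 2) * jt₃ (esymm R) (a + 1) (b + 2) (c + 1)) := by
  obtain ⟨n, hn⟩ : ∃ n : ℕ, d < n := ⟨(d + 1).toNat, by omega⟩
  induction n generalizing a d with
  | zero =>
    rw [esymm_of_neg (r := d) (by omega), esymm_of_neg (r := d - 1) (by omega),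
      esymm_of_neg (r := d - 2) (by omega)]
    simpa using IsDelta.zero
  | succ n ih =>
    have h := (ih (a := a + 1) (d := d - 1) (by omega) (by omega) (by omega) (by omega)).add
      (isDelta_jt₄ (R := R) hbc hac hbd had)
    simp only [jt₄] at h
    convert h using 1 <;> ring_nf

theorem delta_threes_mul_ones {c d : ℤ} (h : d ≤ c + 1) :
    delta (ofParts {2}) (schurExp R c 0 0 * schurExp R 0 0 d) =
      jt₃ (esymm R) (c + 1) (c + 1) c * esymm R d -
        jt₃ (esymm R) (c + 1) (c + 1) (c + 1) * esymm R (d - 1) := by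
  rw [schurExp_threes, schurExp_ones]
  have h1 := (isDelta_pieri (R := R) (a := c) (b := c) (c := c) (d := d) le_rfl (by omega) h
    (by omega)).delta_eq
  -- With equal lengths `c, c, c` every correction term on the source side has two equal rows; on
  -- the target side only the one with lengths `c + 1, c + 1, c + 1` survives.
  convert h1 using 2
  · simp only [jt₃]
    ring_nf
  · simp only [jt₃]
    ring_nf

/-- The terms in `e_{k-2}` cancel, leaving `jt₃ k k (k - 1) * e_{k-1}`. This is Desnanot–Jacobi with
pivot `e_{k-1}` in the second row, first column: the four 2 × 2 minors through the pivot are the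
factors of `D`, once `jt₂ (k - 1) (k - 1) + jt₂ k (k - 2)` is combined into one minor. -/
theorem D_middle_left (k : ℤ) : D R (2 * k) (k - 1) =
    schurExp R k 0 0 * schurExp R 0 0 (k - 2) +
      delta (ofParts {2}) (schurExp R (k - 1) 0 0 * schurExp R 0 0 (k - 1)) := by
  rw [delta_threes_mul_ones (by omega), D_eq, schurExp_threes, schurExp_ones]
  simp only [jt₃, jt₂]
  ring_nf

/-- Desnanot–Jacobi for `jt₃ k k k`, with the lower left corner `e_{k-2}` as pivot. -/
theorem D_middle_right (k : ℤ) :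
    D R (2 * k) k = -(schurExp R k 0 0 * schurExp R 0 0 (k - 2)) := by
  rw [D_eq, schurExp_threes, schurExp_ones]
  simp only [jt₃, jt₂]
  ring_nf

end SymmFun

end

theorem mainTheorem9 (R : Type*) [CommRing R] (k : ℕ) (m : ℤ) (hm : m = 2 * (k : ℤ)) :
    (SymmFun.D R m (k - 1) =
        SymmFun.schurExp R k 0 0 * SymmFun.schurExp R 0 0 (k - 2) +
          SymmFun.delta (SymmFun.ofParts {2})
            (SymmFun.schurExp R (k - 1) 0 0 * SymmFun.schurExp R 0 0 (k - 1)) ∧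
      SymmFun.D R m k =
        -(SymmFun.schurExp R k 0 0 * SymmFun.schurExp R 0 0 (k - 2))) ∧
    (∀ i : ℤ, 0 ≤ i → i ≤ k - 2 →
      SymmFun.D R m i =
          SymmFun.delta (SymmFun.ofParts {2}) (SymmFun.D R (m - 1) i) ∧
        SymmFun.D R m (m - i) =
          SymmFun.delta (SymmFun.ofParts {2}) (SymmFun.D R (m - 1) (m - 1 - i))) ∧
    SymmFun.D R m (m - k + 1) =
      SymmFun.delta (SymmFun.ofParts {2}) (SymmFun.D R (m - 1) (m - k)) := by
  subst hm
  refine ⟨⟨SymmFun.D_middle_left k, SymmFun.D_middle_right k⟩, fun i _ hi => ⟨?_, ?_⟩, ?_⟩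
  · exact (SymmFun.isDelta_D_of_le (by omega)).delta_eq.symm
  · have h := SymmFun.isDelta_D_of_ge (R := R) (m := 2 * k) (i := 2 * k - i) (by omega)
    rw [show (2 * k - i - 1 : ℤ) = 2 * k - 1 - i by ring] at h
    exact h.delta_eq.symm
  · have h := SymmFun.isDelta_D_of_ge (R := R) (m := 2 * k) (i := 2 * k - k + 1) (by omega)
    rw [show (2 * k - k + 1 - 1 : ℤ) = 2 * k - k by ring] at h
    exact h.delta_eq.symm
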